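/- Let $d\ge 1$ and let $X_1,X_2,\dots$ be i.i.d. $\mathbb{Z}^d$-valued random variables; put $S_0=0$ and $S_n=X_1+\dots+X_n$. Let $\ell(n,x)=\#\{0\le i\le n: S_i=x\}$ and, for $\alpha\ge 0$, $L_n(\alpha)=\sum_{x\in\mathbb{Z}^d,\ \ell(n,x)\ge 1}\ell(n,x)^\alpha$ (so $L_n(0)$ is the number of sites visited by time $n$). Assume that: (i) the walk is genuinely $d$-dimensional: with $R^+=\{x\in\mathbb{Z}^d: \mathbb{P}(S_n=x)>0\text{ for some }n\ge 0\}$, the set $R^+-R^+=\{x-y: x,y\in R^+\}$ spans $\mathbb{R}^d$; (ii) the escape probability $\gamma=\mathbb{P}(S_n\ne 0\text{ for all }n\ge 1)$ satisfies $0<\gamma<1$; (iii) if $d\in\{1,2\}$, then $\mathbb{E}|X_1|^2<\infty$ or there is $\eta>0$ such that $\sum_{k\ge n}\mathbb{P}(S_k=0)=O(n^{-\eta})$ as $n\to\infty$. Then for every $\alpha\in[0,\infty)$ the series $\sum_{j\ge1}j^\alpha\gamma^2(1-\gamma)^{j-1}$ converges and, almost surely, $$\lim_{n\to\infty}\frac{L_n(\alpha)}{n}=\sum_{j=1}^{\infty}j^\alpha\gamma^2(1-\gamma)^{j-1}.$$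 -/

import Mathlib

open MeasureTheory ProbabilityTheory Filter Topology Asymptotics

noncomputable section

namespace RandomWalk

variable {Ω : Type*} {d : ℕ}

/-- The walk `S_0 = 0`, `S_n = X_1 + ⋯ + X_n`; the step `X_{i+1}` is written `X i`. -/
def walk (X : ℕ → Ω → (Fin d → ℤ)) (n : ℕ) (ω : Ω) : Fin d → ℤ :=
  ∑ i ∈ Finset.range n, X i ω

/-- The local time `ℓ(n, x) = ∑_{i=0}^n 1{S_i = x}`. -/
def localTime (X : ℕ → Ω → (Fin d → ℤ)) (n : ℕ) (x : Fin d → ℤ) (ω : Ω) : ℕ :=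
  ∑ i ∈ Finset.range (n + 1), if walk X i ω = x then 1 else 0

/-- `L_n(α) = ∑_{x ∈ ℤ^d} ℓ(n, x)^α`. The sum has only finitely many nonzero terms. Sites that
are not visited contribute `0` for every `α`, also for `α = 0`, so that `L_n(0)` is the number of
visited sites. -/
def localTimeSum (X : ℕ → Ω → (Fin d → ℤ)) (α : ℝ) (n : ℕ) (ω : Ω) : ℝ :=
  ∑' x : Fin d → ℤ, if localTime X n x ω = 0 then 0 else (localTime X n x ω : ℝ) ^ α

variable [MeasurableSpace Ω]

/-- The escape probability `γ = P(S_n ≠ 0 for all n ≥ 1)`. -/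
def escapeProb (X : ℕ → Ω → (Fin d → ℤ)) (P : Measure Ω) : ℝ :=
  P.real {ω | ∀ n : ℕ, 1 ≤ n → walk X n ω ≠ 0}

/-- The set `R⁺` of all sites that the walk visits with positive probability. -/
def support (X : ℕ → Ω → (Fin d → ℤ)) (P : Measure Ω) : Set (Fin d → ℤ) :=
  {x | ∃ n : ℕ, 0 < P {ω | walk X n ω = x}}

/-- The walk is genuinely `d`-dimensional: `R⁺ - R⁺`, seen in `ℝ^d`, has linear dimension `d`. -/
def GenuinelyDDimensional (X : ℕ → Ω → (Fin d → ℤ)) (P : Measure Ω) : Prop :=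
  Module.finrank ℝ (Submodule.span ℝ
    {v : Fin d → ℝ | ∃ x ∈ support X P, ∃ y ∈ support X P,
      v = fun i => ((x i - y i : ℤ) : ℝ)}) = d

/-- The steps have a finite second moment: `E |X_1|² < ∞` (Euclidean norm). -/
def FiniteSecondMoment (X : ℕ → Ω → (Fin d → ℤ)) (P : Measure Ω) : Prop :=
  Integrable (fun ω => ∑ i : Fin d, (X 0 ω i : ℝ) ^ 2) P

/-- For some `η > 0`, `∑_{k ≥ n} P(S_k = 0) = O(n^{-η})` as `n → ∞`. -/
def PolynomialReturnTail (X : ℕ → Ω → (Fin d → ℤ)) (P : Measure Ω) : Prop :=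
  Summable (fun k : ℕ => P.real {ω | walk X k ω = 0}) ∧
  ∃ η : ℝ, 0 < η ∧
    (fun n : ℕ => ∑' k : ℕ, P.real {ω | walk X (n + k) ω = 0})
      =O[atTop] (fun n : ℕ => (n : ℝ) ^ (-η))

end RandomWalk

end

/-! Read $L_n(\alpha)$ as a sum over time instead of over sites. At a site visited $\ell$ times,
$\ell^\alpha$ telescopes into increments $j^\alpha-(j-1)^\alpha$; charge to the visit at time $i$
the increment with $j$ the number of visits to $S_i$ during $[i,n]$. Seen from time $i$, $j$ is the
local time at the origin, up to time $n-i$, of the walk with shifted steps (`localTimeSum_eq_sum`).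

Since $\gamma>0$, the local time at the origin increases to an a.s. finite total $N$, and by the
Markov property at the first return $P(N=j)=\gamma(1-\gamma)^{j-1}$ (`measureReal_totalVisits_eq`).
The summand depends on $n-i$ as well as on the shifted steps, so Birkhoff's theorem is not enough;
Maker's theorem (`ae_tendsto_sum_comp_iterate_div`) for the ergodic Bernoulli shift applies, with
dominating function $N^\alpha$. The limit is $E[N^\alpha-(N-1)^\alpha]$, and summation by parts
turns it into the stated series. -/

/-! ### Maximal inequality and pointwise ergodic theorem -/

section PointwiseErgodic

variable {Y : Type*} {T : Y → Y} {f : Y → ℝ}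

/-- The maximum of the Birkhoff sums of `f` of length at most `n`. -/
def birkhoffMax (T : Y → Y) (f : Y → ℝ) : ℕ → Y → ℝ
  | 0, _ => 0
  | n + 1, x => max 0 (f x + birkhoffMax T f n (T x))

theorem birkhoffMax_nonneg (T : Y → Y) (f : Y → ℝ) (n : ℕ) (x : Y) : 0 ≤ birkhoffMax T f n x := by
  cases n with
  | zero => exact le_rfl
  | succ n => exact le_max_left _ _

theorem birkhoffMax_le_succ (T : Y → Y) (f : Y → ℝ) (n : ℕ) (x : Y) :
    birkhoffMax T f n x ≤ birkhoffMax T f (n + 1) x := by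
  induction n generalizing x with
  | zero => exact birkhoffMax_nonneg T f 1 x
  | succ n ih => exact max_le_max le_rfl (add_le_add le_rfl (ih (T x)))

theorem birkhoffSum_le_birkhoffMax (T : Y → Y) (f : Y → ℝ) (n : ℕ) (x : Y) :
    birkhoffSum T f n x ≤ birkhoffMax T f n x := by
  induction n generalizing x with
  | zero => simp [birkhoffMax]
  | succ n ih =>
    rw [birkhoffSum_succ']
    exact (add_le_add le_rfl (ih (T x))).trans (le_max_right _ _)

/-- The term is the difference of two consecutive Birkhoff sums, whose averages have the same limit.
-/
theorem tendsto_birkhoff_term_div {x : Y} {c : ℝ}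
    (h : Tendsto (fun n : ℕ => birkhoffSum T f n x / n) atTop (𝓝 c)) :
    Tendsto (fun n : ℕ => f (T^[n] x) / n) atTop (𝓝 0) := by
  have h1 := (tendsto_add_atTop_iff_nat 1).2 h
  have h2 : Tendsto (fun n : ℕ => ((n + 1 : ℕ) : ℝ) / n) atTop (𝓝 1) := by
    have := (tendsto_const_nhds (x := (1 : ℝ))).add (tendsto_const_div_atTop_nhds_zero_nat (1 : ℝ))
    rw [add_zero] at this
    refine this.congr' ?_
    filter_upwards [eventually_gt_atTop 0] with n hn
    have : (n : ℝ) ≠ 0 := by exact_mod_cast hn.ne'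
    push_cast
    field_simp
  have h3 := (h1.mul h2).sub h
  rw [mul_one, sub_self] at h3
  refine h3.congr fun n => ?_
  have : ((n + 1 : ℕ) : ℝ) ≠ 0 := by positivity
  rw [div_mul_div_cancel₀ this, ← sub_div, birkhoffSum_succ, add_sub_cancel_left]

variable [MeasurableSpace Y] {μ : Measure Y}

theorem measurable_birkhoffMax (hT : Measurable T) (hf : Measurable f) (n : ℕ) :
    Measurable (birkhoffMax T f n) := by
  induction n with
  | zero => exact measurable_const
  | succ n ih => exact measurable_const.max (hf.add (ih.comp hT))

theorem integrable_birkhoffMax (hT : MeasurePreserving T μ μ) (hf : Integrable f μ) (n : ℕ) :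
    Integrable (birkhoffMax T f n) μ := by
  induction n with
  | zero => exact integrable_zero _ _ _
  | succ n ih =>
    exact (integrable_zero Y ℝ μ).sup (hf.add (hT.integrable_comp_of_integrable ih))

/-- The maximal ergodic inequality. -/
theorem setIntegral_birkhoffMax_pos_nonneg (hT : MeasurePreserving T μ μ) (hfm : Measurable f)
    (hf : Integrable f μ) (n : ℕ) :
    0 ≤ ∫ x in {x | 0 < birkhoffMax T f (n + 1) x}, f x ∂μ := by
  set s := {x | 0 < birkhoffMax T f (n + 1) x} with hs
  have hsm : MeasurableSet s :=
    measurableSet_lt measurable_const (measurable_birkhoffMax hT.measurable hfm _)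
  have hi := integrable_birkhoffMax hT hf (n + 1)
  have hi' : Integrable (fun x => birkhoffMax T f n (T x)) μ :=
    hT.integrable_comp_of_integrable (integrable_birkhoffMax hT hf n)
  -- Where the maximum is positive, it is attained by the second entry in the recursion.
  have h1 : ∫ x in s, f x ∂μ =
      ∫ x in s, (birkhoffMax T f (n + 1) x - birkhoffMax T f n (T x)) ∂μ := by
    refine setIntegral_congr_fun hsm fun x hx => ?_
    have hx' : 0 < max 0 (f x + birkhoffMax T f n (T x)) := hx
    have h2 : birkhoffMax T f (n + 1) x = max 0 (f x + birkhoffMax T f n (T x)) := rfl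
    have h3 : 0 < f x + birkhoffMax T f n (T x) := by
      rcases lt_max_iff.1 hx' with h | h
      · exact absurd h (lt_irrefl _)
      · exact h
    simp only [h2, max_eq_right h3.le]
    ring
  rw [h1, integral_sub hi.integrableOn hi'.integrableOn]
  -- The positive term vanishes off `s`, so it loses nothing on `s`; the subtracted one is
  -- nonnegative and only grows when integrated over the whole space, where invariance removes `T`.
  have h2 : ∫ x in s, birkhoffMax T f (n + 1) x ∂μ = ∫ x, birkhoffMax T f (n + 1) x ∂μ := by
    refine setIntegral_eq_integral_of_forall_compl_eq_zero fun x hx => ?_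
    exact le_antisymm (not_lt.1 hx) (birkhoffMax_nonneg _ _ _ _)
  have h3 : ∫ x in s, birkhoffMax T f n (T x) ∂μ ≤ ∫ x, birkhoffMax T f n (T x) ∂μ :=
    setIntegral_le_integral hi' (ae_of_all _ fun x => birkhoffMax_nonneg _ _ _ _)
  have h4 : ∫ x, birkhoffMax T f n (T x) ∂μ = ∫ x, birkhoffMax T f n x ∂μ := by
    conv_rhs => rw [← hT.map_eq]
    rw [integral_map hT.measurable.aemeasurable]
    exact (measurable_birkhoffMax hT.measurable hfm n).aestronglyMeasurable
  have h5 : ∫ x, birkhoffMax T f n x ∂μ ≤ ∫ x, birkhoffMax T f (n + 1) x ∂μ :=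
    integral_mono (integrable_birkhoffMax hT hf n) hi fun x => birkhoffMax_le_succ T f n x
  linarith

/-- Boundedness above is an invariant event, hence null or full. If it were null, the sets in the
maximal inequality would exhaust the space up to a null set, forcing `∫ f ≥ 0`. -/
theorem ae_bddAbove_birkhoffSum [IsProbabilityMeasure μ] (hT : Ergodic T μ) (hfm : Measurable f)
    (hf : Integrable f μ) (hneg : ∫ x, f x ∂μ < 0) :
    ∀ᵐ x ∂μ, ∃ K : ℝ, ∀ n, birkhoffSum T f n x ≤ K := by
  set A : Set Y := {x | ∃ K : ℝ, ∀ n, birkhoffSum T f n x ≤ K} with hA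
  have hSm : ∀ n, Measurable (birkhoffSum T f n) := fun n =>
    Finset.measurable_fun_sum _ fun k _ => hfm.comp (hT.measurable.iterate k)
  have hA' : A = ⋃ K : ℕ, ⋂ n, {x | birkhoffSum T f n x ≤ K} := by
    ext x
    simp only [hA, Set.mem_ofPred_eq, Set.mem_iUnion, Set.mem_iInter]
    constructor
    · rintro ⟨K, hK⟩
      obtain ⟨m, hm⟩ := exists_nat_ge K
      exact ⟨m, fun n => (hK n).trans hm⟩
    · rintro ⟨m, hm⟩
      exact ⟨m, hm⟩
  have hAm : MeasurableSet A := by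
    rw [hA']
    exact MeasurableSet.iUnion fun K => MeasurableSet.iInter fun n =>
      measurableSet_le (hSm n) measurable_const
  have hinv : T ⁻¹' A = A := by
    ext x
    constructor
    · rintro ⟨K, hK⟩
      refine ⟨max 0 (f x + K), fun n => ?_⟩
      cases n with
      | zero => simp
      | succ n =>
        rw [birkhoffSum_succ']
        exact (add_le_add le_rfl (hK n)).trans (le_max_right _ _)
    · rintro ⟨K, hK⟩
      refine ⟨K - f x, fun n => ?_⟩
      have := hK (n + 1)
      rw [birkhoffSum_succ'] at this
      linarith
  rcases hT.toPreErgodic.ae_mem_or_ae_notMem hAm hinv with h | h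
  · exact h
  exfalso
  have hlim : Tendsto (fun n => ∫ x in {x | 0 < birkhoffMax T f (n + 1) x}, f x ∂μ) atTop
      (𝓝 (∫ x, f x ∂μ)) := by
    have hms : ∀ n, MeasurableSet {x | 0 < birkhoffMax T f (n + 1) x} := fun n =>
      measurableSet_lt measurable_const (measurable_birkhoffMax hT.measurable hfm _)
    simp_rw [← fun n => integral_indicator (f := f) (μ := μ) (hms n)]
    refine tendsto_integral_of_dominated_convergence (fun x => ‖f x‖)
      (fun n => (hfm.indicator (hms n)).aestronglyMeasurable) hf.norm
      (fun n => ae_of_all _ fun x => norm_indicator_le_norm_self _ _) ?_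
    filter_upwards [h] with x hx
    obtain ⟨n, hn⟩ : ∃ n, 0 < birkhoffSum T f n x := by
      by_contra! hcon
      exact hx ⟨0, hcon⟩
    refine tendsto_const_nhds.congr' ?_
    filter_upwards [eventually_ge_atTop n] with m hm
    have hmono : Monotone fun n => birkhoffMax T f n x :=
      monotone_nat_of_le_succ fun n => birkhoffMax_le_succ T f n x
    have : 0 < birkhoffMax T f (m + 1) x :=
      (hn.trans_le (birkhoffSum_le_birkhoffMax T f n x)).trans_le (hmono (by omega))
    exact (Set.indicator_of_mem (s := {x | 0 < birkhoffMax T f (m + 1) x}) this f).symm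
  exact absurd (ge_of_tendsto' hlim fun n =>
    setIntegral_birkhoffMax_pos_nonneg hT.toMeasurePreserving hfm hf n) (not_le.2 hneg)

/-- For `q` above the mean, the sums of `f - q` are bounded above, so division by `n` leaves at most
`q` in the limit. Rational `q` keep the exceptional set null uniformly in `c`. -/
theorem ae_eventually_birkhoffSum_div_le [IsProbabilityMeasure μ] (hT : Ergodic T μ)
    (hfm : Measurable f) (hf : Integrable f μ) :
    ∀ᵐ x ∂μ, ∀ c, ∫ x, f x ∂μ < c → ∀ᶠ n : ℕ in atTop, birkhoffSum T f n x / n < c := by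
  have key : ∀ q : ℚ, ∀ᵐ x ∂μ, ∫ x, f x ∂μ < q →
      ∃ K : ℝ, ∀ n : ℕ, birkhoffSum T f n x - n * q ≤ K := by
    intro q
    by_cases hq : ∫ x, f x ∂μ < q
    · have h := ae_bddAbove_birkhoffSum (f := fun x => f x - q) hT (hfm.sub_const _)
        (hf.sub (integrable_const _))
        (by rw [integral_sub hf (integrable_const _)]; simpa using hq)
      filter_upwards [h] with x hx _
      obtain ⟨K, hK⟩ := hx
      refine ⟨K, fun n => ?_⟩
      simpa [birkhoffSum, Finset.sum_sub_distrib] using hK n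
    · exact ae_of_all _ fun x h => absurd h hq
  filter_upwards [ae_all_iff.2 key] with x hx c hc
  obtain ⟨q, hq1, hq2⟩ := exists_rat_btwn hc
  obtain ⟨K, hK⟩ := hx q hq1
  have h1 : Tendsto (fun n : ℕ => (q : ℝ) + K / n) atTop (𝓝 (q + 0)) :=
    tendsto_const_nhds.add (tendsto_const_div_atTop_nhds_zero_nat K)
  rw [add_zero] at h1
  filter_upwards [h1.eventually_lt_const hq2, eventually_gt_atTop 0] with n hn hpos
  refine lt_of_le_of_lt ?_ hn
  have hn' : (0 : ℝ) < n := by exact_mod_cast hpos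
  rw [div_le_iff₀ hn', add_mul, div_mul_cancel₀ _ hn'.ne']
  linarith [hK n]

/-- The pointwise ergodic theorem for ergodic maps. -/
theorem ae_tendsto_birkhoffSum_div [IsProbabilityMeasure μ] (hT : Ergodic T μ)
    (hfm : Measurable f) (hf : Integrable f μ) :
    ∀ᵐ x ∂μ, Tendsto (fun n : ℕ => birkhoffSum T f n x / n) atTop (𝓝 (∫ x, f x ∂μ)) := by
  filter_upwards [ae_eventually_birkhoffSum_div_le hT hfm hf,
    ae_eventually_birkhoffSum_div_le (f := fun x => -f x) hT hfm.neg hf.neg] with x h1 h2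
  refine tendsto_order.2 ⟨fun c hc => ?_, h1⟩
  have := h2 (-c) (by rw [integral_neg]; linarith)
  filter_upwards [this] with n hn
  have h3 : birkhoffSum T (fun x => -f x) n x = -birkhoffSum T f n x := by
    simp [birkhoffSum]
  rw [h3, neg_div] at hn
  linarith

end PointwiseErgodic

/-! ### Maker's ergodic theorem -/

section Maker

/-- The window holds at most `M` indices, and each term is `o(n)`. The constant `ε / (M + 1)` also
covers `M = 0`. -/
theorem sum_window_div_tendsto_zero {e : ℕ → ℝ}
    (h : Tendsto (fun n : ℕ => e n / n) atTop (𝓝 0)) (M : ℕ) :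
    ∀ ε > 0, ∀ᶠ n : ℕ in atTop,
      (∑ i ∈ Finset.range (n + 1), if n < i + M then e i else 0) / n ≤ ε := by
  intro ε hε
  have hδ : 0 < ε / (M + 1) := by positivity
  obtain ⟨I, hI⟩ := eventually_atTop.1 (h.eventually_lt_const hδ)
  filter_upwards [eventually_ge_atTop (I + M + 1)] with n hn
  have hn0 : (0 : ℝ) < n := by exact_mod_cast (by omega : 0 < n)
  rw [div_le_iff₀ hn0]
  have hcard : ((Finset.range (n + 1)).filter fun i => n < i + M).card ≤ M := by
    calc ((Finset.range (n + 1)).filter fun i => n < i + M).card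
        ≤ (Finset.Ioc (n - M) n).card := by
          refine Finset.card_le_card fun i hi => ?_
          simp only [Finset.mem_filter, Finset.mem_range, Finset.mem_Ioc] at hi ⊢
          omega
      _ ≤ M := by rw [Nat.card_Ioc]; omega
  calc (∑ i ∈ Finset.range (n + 1), if n < i + M then e i else 0)
      = ∑ i ∈ (Finset.range (n + 1)).filter fun i => n < i + M, e i :=
        (Finset.sum_filter _ _).symm
    _ ≤ ∑ i ∈ (Finset.range (n + 1)).filter fun i => n < i + M, ε / (M + 1) * n := by
        refine Finset.sum_le_sum fun i hi => ?_
        simp only [Finset.mem_filter, Finset.mem_range] at hi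
        have hi0 : (0 : ℝ) < i := by exact_mod_cast (by omega : 0 < i)
        have h1 := (div_lt_iff₀ hi0).1 (hI i (by omega))
        have h2 : (i : ℝ) ≤ n := by exact_mod_cast (by omega : i ≤ n)
        exact h1.le.trans (mul_le_mul_of_nonneg_left h2 hδ.le)
    _ = ((Finset.range (n + 1)).filter fun i => n < i + M).card * (ε / (M + 1) * n) := by
        rw [Finset.sum_const, nsmul_eq_mul]
    _ ≤ (M + 1 : ℝ) * (ε / (M + 1) * n) := by
        refine mul_le_mul_of_nonneg_right ?_ (by positivity)
        exact (Nat.cast_le.2 hcard).trans (by linarith)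
    _ = ε * n := by field_simp

variable {Y : Type*} [MeasurableSpace Y] {μ : Measure Y} {T : Y → Y} {f : Y → ℝ}

/-- Maker's ergodic theorem: the pointwise ergodic theorem along a dominated, almost everywhere
convergent sequence of observables. -/
theorem ae_tendsto_sum_comp_iterate_div [IsProbabilityMeasure μ] (hT : Ergodic T μ)
    {F : ℕ → Y → ℝ} {G : Y → ℝ} (hF : ∀ m, Measurable (F m)) (hfm : Measurable f)
    (hf : Integrable f μ) (hGm : Measurable G) (hG : Integrable G μ)
    (hbound : ∀ᵐ x ∂μ, ∀ m, |F m x - f x| ≤ G x)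
    (hlim : ∀ᵐ x ∂μ, Tendsto (fun m => F m x) atTop (𝓝 (f x))) :
    ∀ᵐ x ∂μ, Tendsto
      (fun n : ℕ => (∑ i ∈ Finset.range (n + 1), F (n - i) (T^[i] x)) / n) atTop
      (𝓝 (∫ x, f x ∂μ)) := by
  -- Worst error from index `M` on. Its integral tends to 0 by domination; it controls the times `i
  -- ≤ n - M`, while `G` controls the last `M` times.
  let H : ℕ → Y → ℝ := fun M x => ⨆ m, |F (m + M) x - f x|
  have hHm : ∀ M, Measurable (H M) := fun M =>
    Measurable.iSup fun m => ((hF _).sub hfm).abs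
  have hH0 : ∀ M x, 0 ≤ H M x := fun M x => Real.iSup_nonneg fun m => abs_nonneg _
  have hHG : ∀ᵐ x ∂μ, ∀ M, H M x ≤ G x := by
    filter_upwards [hbound] with x hx M
    exact ciSup_le fun m => hx _
  have hHi : ∀ M, Integrable (H M) μ := fun M => by
    refine hG.mono' (hHm M).aestronglyMeasurable ?_
    filter_upwards [hHG] with x hx
    rw [Real.norm_eq_abs, abs_of_nonneg (hH0 M x)]
    exact hx M
  have hHlim : Tendsto (fun M => ∫ x, H M x ∂μ) atTop (𝓝 0) := by
    have h0 : (0 : ℝ) = ∫ _ : Y, (0 : ℝ) ∂μ := by simp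
    rw [h0]
    refine tendsto_integral_of_dominated_convergence G (fun M => (hHm M).aestronglyMeasurable)
      hG (fun M => ?_) ?_
    · filter_upwards [hHG] with x hx
      rw [Real.norm_eq_abs, abs_of_nonneg (hH0 M x)]
      exact hx M
    · filter_upwards [hlim] with x hx
      refine tendsto_order.2 ⟨fun c hc => Eventually.of_forall fun M => hc.trans_le (hH0 M x),
        fun c hc => ?_⟩
      obtain ⟨N, hN⟩ := Metric.tendsto_atTop.1 hx (c / 2) (by linarith)
      filter_upwards [eventually_ge_atTop N] with M hM
      refine lt_of_le_of_lt (ciSup_le fun m => ?_) (half_lt_self hc)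
      exact (hN (m + M) (by omega)).le
  have hiter : ∀ᵐ x ∂μ, ∀ i, ∀ m, |F m (T^[i] x) - f (T^[i] x)| ≤ G (T^[i] x) :=
    ae_all_iff.2 fun i => (hT.toMeasurePreserving.iterate i).quasiMeasurePreserving.ae hbound
  filter_upwards [hiter, ae_tendsto_birkhoffSum_div hT hfm hf, ae_tendsto_birkhoffSum_div hT hGm hG,
    ae_all_iff.2 fun M => ae_tendsto_birkhoffSum_div hT (hHm M) (hHi M)] with x hx h1 h2 h3
  -- The sums have `n + 1` terms but are divided by `n`.
  have hsucc : ∀ {g : Y → ℝ} {c : ℝ},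
      Tendsto (fun n : ℕ => birkhoffSum T g n x / n) atTop (𝓝 c) →
      Tendsto (fun n : ℕ => birkhoffSum T g (n + 1) x / n) atTop (𝓝 c) := by
    intro g c hg
    have := hg.add (tendsto_birkhoff_term_div hg)
    rw [add_zero] at this
    refine this.congr fun n => ?_
    rw [birkhoffSum_succ, add_div]
  have hdiff : Tendsto (fun n : ℕ =>
      (∑ i ∈ Finset.range (n + 1), (F (n - i) (T^[i] x) - f (T^[i] x))) / n) atTop (𝓝 0) := by
    refine tendsto_zero_iff_abs_tendsto_zero _ |>.2 (tendsto_order.2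
      ⟨fun c hc => Eventually.of_forall fun n => hc.trans_le (abs_nonneg _), fun c hc => ?_⟩)
    obtain ⟨M, hM⟩ := (hHlim.eventually_lt_const (half_pos hc)).exists
    filter_upwards [(hsucc (h3 M)).eventually_lt_const hM,
      sum_window_div_tendsto_zero (tendsto_birkhoff_term_div h2) M (c / 2) (half_pos hc)]
      with n hn1 hn2
    have hle : |(∑ i ∈ Finset.range (n + 1), (F (n - i) (T^[i] x) - f (T^[i] x))) / n| ≤
        birkhoffSum T (H M) (n + 1) x / n +
        (∑ i ∈ Finset.range (n + 1), if n < i + M then G (T^[i] x) else 0) / n := by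
      rw [abs_div, Nat.abs_cast, ← add_div]
      refine div_le_div_of_nonneg_right ?_ (Nat.cast_nonneg n)
      refine (Finset.abs_sum_le_sum_abs _ _).trans ?_
      rw [birkhoffSum, ← Finset.sum_add_distrib]
      refine Finset.sum_le_sum fun i hi => ?_
      by_cases hiM : n < i + M
      · rw [if_pos hiM]
        exact (hx i _).trans (le_add_of_nonneg_left (hH0 _ _))
      · rw [if_neg hiM, add_zero]
        have hbdd : BddAbove (Set.range fun m => |F (m + M) (T^[i] x) - f (T^[i] x)|) :=
          ⟨G (T^[i] x), by rintro _ ⟨m, rfl⟩; exact hx i _⟩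
        have := le_ciSup hbdd (n - i - M)
        rwa [show n - i - M + M = n - i by omega] at this
    exact hle.trans_lt (by linarith)
  have := hdiff.add (hsucc h1)
  rw [zero_add] at this
  refine this.congr fun n => ?_
  rw [← add_div, birkhoffSum, ← Finset.sum_add_distrib]
  simp

end Maker

/-! ### Ergodicity of the Bernoulli shift -/

section Shift

variable {E : Type*} [MeasurableSpace E]

/-- The left shift on sequences. -/
def shift (y : ℕ → E) : ℕ → E := fun i => y (i + 1)

omit [MeasurableSpace E] in
theorem shift_iterate_apply (m : ℕ) (y : ℕ → E) (i : ℕ) : shift^[m] y i = y (i + m) := by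
  induction m generalizing y with
  | zero => rfl
  | succ m ih => rw [Function.iterate_succ_apply, ih, shift, add_assoc]

/-- The σ-algebra on sequences generated by the coordinates in `s`. -/
abbrev coordSigma (E : Type*) [MeasurableSpace E] (s : Set ℕ) : MeasurableSpace (ℕ → E) :=
  ⨆ i ∈ s, MeasurableSpace.comap (fun y : ℕ → E => y i) inferInstance

theorem measurable_coordSigma_apply {s : Set ℕ} {i : ℕ} (hi : i ∈ s) :
    Measurable[coordSigma E s] fun y : ℕ → E => y i :=
  (comap_measurable fun y : ℕ → E => y i).mono
    (le_iSup₂ (f := fun i (_ : i ∈ s) =>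
      MeasurableSpace.comap (fun y : ℕ → E => y i) inferInstance) i hi) le_rfl

theorem measurable_coordSigma_shift_iterate (m : ℕ) :
    Measurable[coordSigma E (Set.Ici m)] (shift^[m] : (ℕ → E) → ℕ → E) := by
  refine @measurable_pi_lambda _ _ _ (coordSigma E (Set.Ici m)) _ _ fun i => ?_
  simp_rw [shift_iterate_apply]
  exact measurable_coordSigma_apply (by simp)

variable (ν : Measure E) [IsProbabilityMeasure ν]

theorem iIndep_coord_infinitePi :
    iIndep (fun i => MeasurableSpace.comap (fun y : ℕ → E => y i) inferInstance)
      (Measure.infinitePi fun _ : ℕ => ν) :=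
  (iIndepFun_infinitePi (P := fun _ : ℕ => ν) (X := fun _ x => x) fun _ => measurable_id)

theorem indep_coordSigma {s t : Set ℕ} (hst : Disjoint s t) :
    Indep (coordSigma E s) (coordSigma E t) (Measure.infinitePi fun _ : ℕ => ν) :=
  indep_iSup_of_disjoint (fun i => (measurable_pi_apply i).comap_le)
    (iIndep_coord_infinitePi ν) hst

theorem measurePreserving_shift :
    MeasurePreserving (shift : (ℕ → E) → ℕ → E) (Measure.infinitePi fun _ : ℕ => ν)
      (Measure.infinitePi fun _ : ℕ => ν) :=
  ⟨measurable_pi_lambda _ fun i => measurable_pi_apply (i + 1),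
    Measure.map_infinitePi_infinitePi_of_inj (P := fun _ : ℕ => ν) (add_left_injective 1)⟩

/-- Bernoulli shifts are ergodic. -/
theorem ergodic_shift :
    Ergodic (shift : (ℕ → E) → ℕ → E) (Measure.infinitePi fun _ : ℕ => ν) where
  toMeasurePreserving := measurePreserving_shift ν
  toPreErgodic := by
    refine ⟨fun {s} hs hinv => ?_⟩
    -- An invariant set is its own preimage under every `shift^[m]`, so it depends only on
    -- coordinates from `m` on, for each `m`; Kolmogorov's zero-one law applies.
    have htail : MeasurableSet[limsup
        (fun i => MeasurableSpace.comap (fun y : ℕ → E => y i) inferInstance) atTop] s := by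
      rw [limsup_eq_iInf_iSup_of_nat]
      refine MeasurableSpace.measurableSet_iInf.2 fun m => ?_
      have h1 : shift^[m] ⁻¹' s = s := by
        induction m with
        | zero => rfl
        | succ m ih => rw [Function.iterate_succ, Set.preimage_comp, ih, hinv]
      rw [← h1]
      exact measurable_coordSigma_shift_iterate m hs
    have h01 := measure_zero_or_one_of_measurableSet_limsup_atTop
      (fun i => (measurable_pi_apply i).comap_le) (iIndep_coord_infinitePi ν) htail
    refine eventuallyConst_set'.2 ?_
    rcases h01 with h | h
    · exact Or.inl (ae_eq_empty.2 h)
    · exact Or.inr (ae_eq_univ.2 ((prob_compl_eq_zero_iff hs).2 h))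

end Shift

/-! ### Local time sums as sums over time -/

namespace RandomWalk

/-- The steps of the canonical walk, i.e. the coordinates of the space of step sequences. -/
def coord (d : ℕ) : ℕ → (ℕ → Fin d → ℤ) → (Fin d → ℤ) := fun i y => y i

/-- `j ^ α`, with the value `0` at `j = 0` for all `α`. -/
noncomputable def powZero (α : ℝ) (j : ℕ) : ℝ := if j = 0 then 0 else (j : ℝ) ^ α

/-- The increment `j ^ α - (j - 1) ^ α`. -/
noncomputable def powIncr (α : ℝ) (j : ℕ) : ℝ := powZero α j - powZero α (j - 1)

theorem powZero_nonneg (α : ℝ) (j : ℕ) : 0 ≤ powZero α j := by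
  unfold powZero
  split_ifs
  · exact le_rfl
  · positivity

theorem powZero_mono {α : ℝ} (hα : 0 ≤ α) : Monotone (powZero α) := by
  intro i j hij
  by_cases hi : i = 0
  · rw [hi]
    exact powZero_nonneg α j
  · rw [powZero, powZero, if_neg hi, if_neg (by omega)]
    exact Real.rpow_le_rpow (Nat.cast_nonneg i) (Nat.cast_le.2 hij) hα

theorem powIncr_nonneg {α : ℝ} (hα : 0 ≤ α) (j : ℕ) : 0 ≤ powIncr α j :=
  sub_nonneg.2 (powZero_mono hα (Nat.sub_le j 1))

theorem powIncr_le (α : ℝ) (j : ℕ) : powIncr α j ≤ powZero α j :=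
  sub_le_self _ (powZero_nonneg α _)

variable {d : ℕ}

theorem walk_add (m n : ℕ) (y : ℕ → Fin d → ℤ) :
    walk (coord d) (m + n) y = walk (coord d) m y + walk (coord d) n (shift^[m] y) := by
  simp only [walk, coord, Finset.sum_range_add, shift_iterate_apply]
  congr 1
  exact Finset.sum_congr rfl fun i _ => by rw [add_comm]

/-- After its first step the walk is the shifted walk translated by `y 0`; the last summand is the
visit at time 0. -/
theorem localTime_succ (n : ℕ) (x : Fin d → ℤ) (y : ℕ → Fin d → ℤ) :
    localTime (coord d) (n + 1) x y =
      localTime (coord d) n (x - y 0) (shift y) + if x = 0 then 1 else 0 := by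
  rw [localTime, Finset.sum_range_succ', localTime]
  congr 1
  · refine Finset.sum_congr rfl fun i _ => ?_
    have h : walk (coord d) (i + 1) y = y 0 + walk (coord d) i (shift y) := by
      rw [add_comm i 1, walk_add]
      simp [walk, coord]
    rw [h]
    simp only [eq_sub_iff_add_eq, add_comm]
  · simp [walk, eq_comm]

theorem finite_support_localTime (n : ℕ) (y : ℕ → Fin d → ℤ) :
    (Function.support fun x => localTime (coord d) n x y).Finite := by
  refine ((Finset.range (n + 1)).image fun i => walk (coord d) i y).finite_toSet.subset ?_
  intro x hx
  obtain ⟨i, hi, h⟩ := Finset.exists_ne_zero_of_sum_ne_zero (Function.mem_support.1 hx)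
  simp only [Finset.coe_image, Set.mem_image, Finset.mem_coe]
  exact ⟨i, hi, by simpa using h⟩

theorem localTimeSum_eq (α : ℝ) (n : ℕ) (y : ℕ → Fin d → ℤ) :
    localTimeSum (coord d) α n y = ∑' x, powZero α (localTime (coord d) n x y) := rfl

theorem summable_powZero_localTime (α : ℝ) (n : ℕ) (y : ℕ → Fin d → ℤ) :
    Summable fun x => powZero α (localTime (coord d) n x y) := by
  refine summable_of_hasFiniteSupport ((finite_support_localTime n y).subset fun x hx h => hx ?_)
  simp only [h, powZero, if_true]

/-- Dropping the first step translates all sites, which leaves the sum unchanged, and removes one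
visit at the origin only. -/
theorem localTimeSum_succ (α : ℝ) (n : ℕ) (y : ℕ → Fin d → ℤ) :
    localTimeSum (coord d) α (n + 1) y =
      localTimeSum (coord d) α n (shift y) + powIncr α (localTime (coord d) (n + 1) 0 y) := by
  have h1 : ∀ x, powZero α (localTime (coord d) (n + 1) x y) =
      powZero α (localTime (coord d) n (x - y 0) (shift y)) +
        if x = 0 then powIncr α (localTime (coord d) (n + 1) 0 y) else 0 := by
    intro x
    by_cases hx : x = 0
    · subst hx
      simp [powIncr, localTime_succ]
    · simp [localTime_succ, hx]
  have h2 : Summable fun x => powZero α (localTime (coord d) n (x - y 0) (shift y)) :=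
    (summable_powZero_localTime α n (shift y)).comp_injective (sub_left_injective (b := y 0))
  have h3 : Summable fun x : Fin d → ℤ =>
      if x = 0 then powIncr α (localTime (coord d) (n + 1) 0 y) else 0 :=
    summable_of_hasFiniteSupport
      ((Set.finite_singleton 0).subset fun x hx => by_contra fun h => hx (if_neg h))
  rw [localTimeSum_eq, tsum_congr h1, h2.tsum_add h3,
    tsum_ite_eq, localTimeSum_eq]
  congr 1
  exact (Equiv.subRight (y 0)).tsum_eq
    fun x => powZero α (localTime (coord d) n x (shift y))

theorem localTimeSum_zero (α : ℝ) (y : ℕ → Fin d → ℤ) :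
    localTimeSum (coord d) α 0 y = powIncr α (localTime (coord d) 0 0 y) := by
  have h : ∀ x, powZero α (localTime (coord d) 0 x y) = if x = 0 then 1 else 0 := by
    intro x
    by_cases hx : x = 0
    · subst hx
      simp [localTime, walk, powZero]
    · simp [localTime, walk, powZero, hx, Ne.symm hx]
  rw [localTimeSum_eq, tsum_congr h, tsum_ite_eq]
  simp [localTime, walk, powIncr, powZero]

/-- `L_n(α)` as a sum over time: each visit contributes the increment of `j ^ α` at the number of
visits to the current site that are still to come (the present one included). -/
theorem localTimeSum_eq_sum (α : ℝ) (n : ℕ) (y : ℕ → Fin d → ℤ) :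
    localTimeSum (coord d) α n y =
      ∑ i ∈ Finset.range (n + 1), powIncr α (localTime (coord d) (n - i) 0 (shift^[i] y)) := by
  induction n generalizing y with
  | zero => simp [localTimeSum_zero]
  | succ n ih =>
    rw [localTimeSum_succ, ih, Finset.sum_range_succ' _ (n + 1)]
    simp only [Nat.add_sub_add_right, Function.iterate_succ_apply, Nat.sub_zero,
      Function.iterate_zero, id]

/-! ### First returns and the geometric law of the number of visits -/

/-- The event that the first return to the origin happens at time `m + 1`. -/
def firstReturn (d m : ℕ) : Set (ℕ → Fin d → ℤ) :=
  {y | walk (coord d) (m + 1) y = 0 ∧ ∀ k < m, walk (coord d) (k + 1) y ≠ 0}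

/-- The event that the origin is visited at least `j` times. -/
def visitsAtLeast (d j : ℕ) : Set (ℕ → Fin d → ℤ) :=
  {y | ∃ n, j ≤ localTime (coord d) n 0 y}

theorem localTime_zero_pos (n : ℕ) (y : ℕ → Fin d → ℤ) : 1 ≤ localTime (coord d) n 0 y := by
  rw [localTime, Finset.sum_range_succ']
  simp [walk]

theorem localTime_mono (y : ℕ → Fin d → ℤ) : Monotone fun n => localTime (coord d) n 0 y := by
  refine monotone_nat_of_le_succ fun n => ?_
  rw [localTime, localTime, Finset.sum_range_succ _ (n + 1)]
  exact Nat.le_add_right _ _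

/-- Before the return only time 0 counts; from the return on, the walk starts afresh at the origin.
-/
theorem localTime_of_mem_firstReturn {m : ℕ} {y : ℕ → Fin d → ℤ} (hy : y ∈ firstReturn d m)
    (k : ℕ) : localTime (coord d) (m + 1 + k) 0 y =
      localTime (coord d) k 0 (shift^[m + 1] y) + 1 := by
  rw [localTime, add_assoc (m + 1) k 1, Finset.sum_range_add, add_comm, localTime]
  congr 1
  · simp only [walk_add (m + 1), hy.1, zero_add]
  · rw [Finset.sum_range_succ', Finset.sum_eq_zero]
    · simp [walk]
    · intro i hi
      exact if_neg (hy.2 i (Finset.mem_range.1 hi))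

theorem exists_mem_firstReturn {m : ℕ} {y : ℕ → Fin d → ℤ} (h : walk (coord d) (m + 1) y = 0) :
    ∃ k ≤ m, y ∈ firstReturn d k := by
  classical
  have hex : ∃ m, walk (coord d) (m + 1) y = 0 := ⟨m, h⟩
  exact ⟨Nat.find hex, Nat.find_min' hex h, Nat.find_spec hex, fun k hk => Nat.find_min hex hk⟩

theorem disjoint_firstReturn : Pairwise fun i j => Disjoint (firstReturn d i) (firstReturn d j) := by
  intro i j hij
  refine Set.disjoint_left.2 fun y hi hj => ?_
  rcases lt_or_gt_of_ne hij with h | h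
  · exact hj.2 i h hi.1
  · exact hi.2 j h hj.1

theorem iUnion_firstReturn :
    ⋃ m, firstReturn d m = {y | ∀ n : ℕ, 1 ≤ n → walk (coord d) n y ≠ 0}ᶜ := by
  ext y
  rw [Set.mem_iUnion, Set.mem_compl_iff]
  constructor
  · rintro ⟨m, hm⟩ h
    exact h (m + 1) (by omega) hm.1
  · intro h
    have : ∃ n : ℕ, 1 ≤ n ∧ walk (coord d) n y = 0 := by
      by_contra! hcon
      exact h hcon
    obtain ⟨n, hn, h0⟩ := this
    obtain ⟨m, rfl⟩ := Nat.exists_eq_add_of_le' hn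
    obtain ⟨k, _, hk⟩ := exists_mem_firstReturn h0
    exact ⟨k, hk⟩

/-- Time 0 always counts as a visit, so a second visit is a first return, from which `j + 1` visits
remain. -/
theorem visitsAtLeast_add_two (j : ℕ) : visitsAtLeast d (j + 2) =
    ⋃ m, firstReturn d m ∩ shift^[m + 1] ⁻¹' visitsAtLeast d (j + 1) := by
  ext y
  rw [Set.mem_iUnion]
  constructor
  · rintro ⟨n, hn⟩
    have h1 : ∃ i < n, walk (coord d) (i + 1) y = 0 := by
      by_contra! hcon
      rw [localTime, Finset.sum_range_succ', Finset.sum_eq_zero] at hn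
      · simp [walk] at hn
      · intro i hi
        exact if_neg (hcon i (Finset.mem_range.1 hi))
    obtain ⟨i, hi, h0⟩ := h1
    obtain ⟨m, hm, hy⟩ := exists_mem_firstReturn h0
    obtain ⟨k, rfl⟩ := Nat.exists_eq_add_of_le (show m + 1 ≤ n by omega)
    rw [localTime_of_mem_firstReturn hy] at hn
    exact ⟨m, hy, k, by omega⟩
  · rintro ⟨m, hy, k, hk⟩
    refine ⟨m + 1 + k, ?_⟩
    rw [localTime_of_mem_firstReturn hy]
    omega

theorem measurable_walk (m : ℕ) : Measurable (walk (coord d) m) :=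
  Finset.measurable_fun_sum _ fun _ _ => measurable_pi_apply _

theorem measurable_localTime (n : ℕ) (x : Fin d → ℤ) : Measurable (localTime (coord d) n x) :=
  Finset.measurable_fun_sum _ fun i _ => Measurable.ite
    (measurable_walk i (measurableSet_singleton x)) measurable_const measurable_const

theorem measurableSet_visitsAtLeast (j : ℕ) : MeasurableSet (visitsAtLeast d j) := by
  have : visitsAtLeast d j = ⋃ n, {y | j ≤ localTime (coord d) n 0 y} := by
    ext y
    simp [visitsAtLeast]
  rw [this]
  exact MeasurableSet.iUnion fun n => measurableSet_le measurable_const (measurable_localTime n 0)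

theorem measurable_walk_coordSigma {k m : ℕ} (hk : k ≤ m) :
    Measurable[coordSigma (Fin d → ℤ) (Set.Iio m)] (walk (coord d) k) :=
  @Finset.measurable_fun_sum _ _ _ _ _ _ (coordSigma (Fin d → ℤ) (Set.Iio m)) _ _
    fun _ hi => measurable_coordSigma_apply (Set.mem_Iio.2 ((Finset.mem_range.1 hi).trans_le hk))

/-- Only the first `m + 1` steps matter, which makes this event independent of anything seen after
`shift^[m + 1]`. -/
theorem measurableSet_firstReturn_coordSigma (m : ℕ) :
    MeasurableSet[coordSigma (Fin d → ℤ) (Set.Iio (m + 1))] (firstReturn d m) := by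
  have : firstReturn d m = walk (coord d) (m + 1) ⁻¹' {0} ∩
      ⋂ k, ⋂ (_ : k < m), walk (coord d) (k + 1) ⁻¹' {0}ᶜ := by
    ext y
    simp [firstReturn]
  rw [this]
  refine MeasurableSet.inter (measurable_walk_coordSigma le_rfl (measurableSet_singleton 0)) ?_
  refine MeasurableSet.iInter fun k => MeasurableSet.iInter fun hk => ?_
  exact measurable_walk_coordSigma (by omega) (measurableSet_singleton 0).compl

theorem measurableSet_firstReturn (m : ℕ) : MeasurableSet (firstReturn d m) :=
  iSup₂_le (fun i _ => (measurable_pi_apply i).comap_le) _ (measurableSet_firstReturn_coordSigma m)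

variable (ν : Measure (Fin d → ℤ)) [IsProbabilityMeasure ν]

/-- By the Markov property at the first return, the number of visits is geometric. -/
theorem measure_visitsAtLeast_add_two (j : ℕ) :
    (Measure.infinitePi fun _ : ℕ => ν) (visitsAtLeast d (j + 2)) =
      (Measure.infinitePi fun _ : ℕ => ν) {y | ∀ n : ℕ, 1 ≤ n → walk (coord d) n y ≠ 0}ᶜ *
        (Measure.infinitePi fun _ : ℕ => ν) (visitsAtLeast d (j + 1)) := by
  have hshift : ∀ m, MeasurePreserving (shift^[m] : (ℕ → Fin d → ℤ) → _)
      (Measure.infinitePi fun _ : ℕ => ν) (Measure.infinitePi fun _ : ℕ => ν) :=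
    fun m => (measurePreserving_shift ν).iterate m
  rw [visitsAtLeast_add_two, measure_iUnion
    (fun a b hab => (disjoint_firstReturn hab).mono Set.inter_subset_left Set.inter_subset_left)
    (fun m => (measurableSet_firstReturn m).inter
      ((hshift _).measurable (measurableSet_visitsAtLeast _))),
    ← iUnion_firstReturn, measure_iUnion disjoint_firstReturn measurableSet_firstReturn,
    ← ENNReal.tsum_mul_right]
  refine tsum_congr fun m => ?_
  have hind := indep_coordSigma ν (s := Set.Iio (m + 1)) (t := Set.Ici (m + 1))
    (Set.disjoint_left.2 fun i hi hi' => absurd (Set.mem_Iio.1 hi) (not_lt.2 hi'))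
  rw [Indep_iff] at hind
  rw [hind _ _ (measurableSet_firstReturn_coordSigma m)
    (measurable_coordSigma_shift_iterate (m + 1) (measurableSet_visitsAtLeast _)),
    (hshift (m + 1)).measure_preimage (measurableSet_visitsAtLeast _).nullMeasurableSet]

theorem measurableSet_escape :
    MeasurableSet {y | ∀ n : ℕ, 1 ≤ n → walk (coord d) n y ≠ 0} := by
  rw [← MeasurableSet.compl_iff, ← iUnion_firstReturn]
  exact MeasurableSet.iUnion measurableSet_firstReturn

theorem measureReal_visitsAtLeast (j : ℕ) :
    (Measure.infinitePi fun _ : ℕ => ν).real (visitsAtLeast d (j + 1)) =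
      (1 - escapeProb (coord d) (Measure.infinitePi fun _ : ℕ => ν)) ^ j := by
  induction j with
  | zero =>
    have : visitsAtLeast d (0 + 1) = Set.univ :=
      Set.eq_univ_of_forall fun y => ⟨0, localTime_zero_pos 0 y⟩
    simp [this]
  | succ j ih =>
    rw [measureReal_def, measure_visitsAtLeast_add_two, ENNReal.toReal_mul, ← measureReal_def,
      ← measureReal_def, ih, probReal_compl_eq_one_sub measurableSet_escape, pow_succ', escapeProb]

/-- The total number of visits to the origin (`0` if there are infinitely many). -/
noncomputable def totalVisits (d : ℕ) (y : ℕ → Fin d → ℤ) : ℕ := ⨆ n, localTime (coord d) n 0 y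

theorem measurable_totalVisits : Measurable (totalVisits d) :=
  Measurable.iSup fun n => measurable_localTime n 0

/-- The probability $(1-\gamma)^j$ of at least $j+1$ visits tends to 0 because $\gamma>0$. -/
theorem ae_bddAbove_localTime
    (hγ : 0 < escapeProb (coord d) (Measure.infinitePi fun _ : ℕ => ν)) :
    ∀ᵐ y ∂(Measure.infinitePi fun _ : ℕ => ν),
      BddAbove (Set.range fun n => localTime (coord d) n 0 y) := by
  have hγ1 : escapeProb (coord d) (Measure.infinitePi fun _ : ℕ => ν) ≤ 1 := measureReal_le_one
  have h0 : (Measure.infinitePi fun _ : ℕ => ν).real (⋂ j, visitsAtLeast d (j + 1)) = 0 := by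
    refine le_antisymm (ge_of_tendsto' (tendsto_pow_atTop_nhds_zero_of_lt_one (sub_nonneg.2 hγ1)
      (sub_lt_self 1 hγ)) fun j => ?_) measureReal_nonneg
    rw [← measureReal_visitsAtLeast]
    exact measureReal_mono (Set.iInter_subset _ j)
  rw [measureReal_eq_zero_iff] at h0
  filter_upwards [measure_eq_zero_iff_ae_notMem.1 h0] with y hy
  simp only [Set.mem_iInter, not_forall] at hy
  obtain ⟨j, hj⟩ := hy
  refine ⟨j, ?_⟩
  rintro _ ⟨n, rfl⟩
  by_contra hcon
  exact hj ⟨n, by simpa using hcon⟩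

theorem eventually_localTime_eq {y : ℕ → Fin d → ℤ}
    (hy : BddAbove (Set.range fun n => localTime (coord d) n 0 y)) :
    ∀ᶠ n in atTop, localTime (coord d) n 0 y = totalVisits d y := by
  -- A bounded set of naturals attains its supremum.
  obtain ⟨N, hN⟩ : ∃ N, localTime (coord d) N 0 y = totalVisits d y :=
    Nat.sSup_mem (Set.range_nonempty _) hy
  filter_upwards [eventually_ge_atTop N] with n hn
  exact le_antisymm (le_ciSup hy n) (hN ▸ localTime_mono y hn)

theorem mem_visitsAtLeast_iff {y : ℕ → Fin d → ℤ}
    (hy : BddAbove (Set.range fun n => localTime (coord d) n 0 y)) (j : ℕ) :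
    y ∈ visitsAtLeast d j ↔ j ≤ totalVisits d y := by
  constructor
  · rintro ⟨n, hn⟩
    exact hn.trans (le_ciSup hy n)
  · intro h
    obtain ⟨n, hn⟩ := (eventually_localTime_eq hy).exists
    exact ⟨n, h.trans hn.ge⟩

theorem measureReal_totalVisits_eq
    (hγ : 0 < escapeProb (coord d) (Measure.infinitePi fun _ : ℕ => ν)) (j : ℕ) :
    (Measure.infinitePi fun _ : ℕ => ν).real (totalVisits d ⁻¹' {j + 1}) =
      escapeProb (coord d) (Measure.infinitePi fun _ : ℕ => ν) *
        (1 - escapeProb (coord d) (Measure.infinitePi fun _ : ℕ => ν)) ^ j := by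
  have h1 : (Measure.infinitePi fun _ : ℕ => ν).real (totalVisits d ⁻¹' {j + 1}) =
      (Measure.infinitePi fun _ : ℕ => ν).real
        (visitsAtLeast d (j + 1) \ visitsAtLeast d (j + 1 + 1)) := by
    refine measureReal_congr (eventuallyEq_set.2 ?_)
    filter_upwards [ae_bddAbove_localTime ν hγ] with y hy
    rw [Set.mem_sdiff, mem_visitsAtLeast_iff hy, mem_visitsAtLeast_iff hy, Set.mem_preimage,
      Set.mem_singleton_iff]
    omega
  have hsub : visitsAtLeast d (j + 1 + 1) ⊆ visitsAtLeast d (j + 1) := by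
    rintro y ⟨n, hn⟩
    exact ⟨n, by omega⟩
  rw [h1, measureReal_sdiff hsub (measurableSet_visitsAtLeast _), measureReal_visitsAtLeast,
    measureReal_visitsAtLeast]
  ring

end RandomWalk

/-! ### Expectations under the geometric law and the limit -/

namespace RandomWalk

theorem summable_powZero_mul_geometric (α : ℝ) {r : ℝ} (hr0 : 0 ≤ r) (hr1 : r < 1) :
    Summable fun j : ℕ => powZero α (j + 1) * r ^ j := by
  have h1 : Summable fun j : ℕ => (j : ℝ) ^ ⌈α⌉₊ * r ^ j :=
    summable_pow_mul_geometric_of_norm_lt_one _ (by rwa [Real.norm_of_nonneg hr0])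
  have h2 : Summable fun j : ℕ => ((j + 1 : ℕ) : ℝ) ^ ⌈α⌉₊ * r ^ j := by
    -- The index shift divides by `r`, so `r = 0` is treated apart; there only the term `j = 0`
    -- survives.
    rcases hr0.eq_or_lt with rfl | hr
    · refine summable_of_hasFiniteSupport ((Set.finite_singleton 0).subset fun j hj => ?_)
      by_contra h
      exact hj (by simp [zero_pow (show j ≠ 0 from h)])
    · refine (((summable_nat_add_iff 1).2 h1).mul_left r⁻¹).congr fun j => ?_
      rw [pow_succ]
      field_simp
  refine h2.of_nonneg_of_le (fun j => mul_nonneg (powZero_nonneg _ _) (pow_nonneg hr0 j))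
    fun j => mul_le_mul_of_nonneg_right ?_ (pow_nonneg hr0 j)
  rw [powZero, if_neg j.succ_ne_zero, ← Real.rpow_natCast]
  exact Real.rpow_le_rpow_of_exponent_le (by simp) (Nat.le_ceil α)

/-- Summation by parts against a geometric sequence. -/
theorem tsum_powIncr_mul_geometric (α : ℝ) {r : ℝ} (hr0 : 0 ≤ r) (hr1 : r < 1) :
    ∑' j : ℕ, powIncr α (j + 1) * r ^ j = ∑' j : ℕ, powZero α (j + 1) * (1 - r) * r ^ j := by
  have h := summable_powZero_mul_geometric α hr0 hr1
  have h0 : Summable fun j : ℕ => powZero α j * r ^ j := by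
    refine (summable_nat_add_iff 1).1 ((h.mul_left r).congr fun j => ?_)
    ring
  have h1 : ∑' j : ℕ, powZero α j * r ^ j = r * ∑' j : ℕ, powZero α (j + 1) * r ^ j := by
    rw [h0.tsum_eq_zero_add, ← tsum_mul_left]
    simp only [powZero, if_true, zero_mul, zero_add]
    exact tsum_congr fun j => by ring
  calc ∑' j : ℕ, powIncr α (j + 1) * r ^ j
      = ∑' j : ℕ, (powZero α (j + 1) * r ^ j - powZero α j * r ^ j) :=
        tsum_congr fun j => by rw [powIncr, Nat.add_sub_cancel, sub_mul]
    _ = (1 - r) * ∑' j : ℕ, powZero α (j + 1) * r ^ j := by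
        rw [h.tsum_sub h0, h1]
        ring
    _ = ∑' j : ℕ, powZero α (j + 1) * (1 - r) * r ^ j := by
        rw [← tsum_mul_left]
        exact tsum_congr fun j => by ring

variable {d : ℕ} (ν : Measure (Fin d → ℤ)) [IsProbabilityMeasure ν]

theorem integrable_comp_totalVisits {g : ℕ → ℝ}
    (hγ : 0 < escapeProb (coord d) (Measure.infinitePi fun _ : ℕ => ν))
    (hg : Summable fun j : ℕ =>
      |g (j + 1)| * (1 - escapeProb (coord d) (Measure.infinitePi fun _ : ℕ => ν)) ^ j) :
    Integrable (fun y => g (totalVisits d y)) (Measure.infinitePi fun _ : ℕ => ν) := by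
  have h : Integrable g ((Measure.infinitePi fun _ : ℕ => ν).map (totalVisits d)) := by
    have := Measure.isProbabilityMeasure_map (μ := Measure.infinitePi fun _ : ℕ => ν)
      (measurable_totalVisits (d := d)).aemeasurable
    rw [← Measure.sum_smul_dirac ((Measure.infinitePi fun _ : ℕ => ν).map (totalVisits d)),
      integrable_sum_dirac_iff fun i => measure_ne_top _ _]
    refine (summable_nat_add_iff 1).1 ((hg.mul_left
      (escapeProb (coord d) (Measure.infinitePi fun _ : ℕ => ν))).congr fun j => ?_)
    rw [← measureReal_def, map_measureReal_apply measurable_totalVisits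
      (measurableSet_singleton _), measureReal_totalVisits_eq ν hγ, Real.norm_eq_abs]
    ring
  exact h.comp_measurable measurable_totalVisits

/-- On the law of `totalVisits` this is a sum over its atoms; `g 0 = 0` discards the default value 0
used for infinitely many visits. -/
theorem integral_comp_totalVisits {g : ℕ → ℝ} (hg0 : g 0 = 0)
    (hγ : 0 < escapeProb (coord d) (Measure.infinitePi fun _ : ℕ => ν))
    (hg : Summable fun j : ℕ =>
      |g (j + 1)| * (1 - escapeProb (coord d) (Measure.infinitePi fun _ : ℕ => ν)) ^ j) :
    ∫ y, g (totalVisits d y) ∂(Measure.infinitePi fun _ : ℕ => ν) =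
      escapeProb (coord d) (Measure.infinitePi fun _ : ℕ => ν) * ∑' j : ℕ,
        g (j + 1) * (1 - escapeProb (coord d) (Measure.infinitePi fun _ : ℕ => ν)) ^ j := by
  have hgm : AEStronglyMeasurable g ((Measure.infinitePi fun _ : ℕ => ν).map (totalVisits d)) :=
    (measurable_of_countable g).aestronglyMeasurable
  have h : Integrable g ((Measure.infinitePi fun _ : ℕ => ν).map (totalVisits d)) :=
    (integrable_map_measure hgm measurable_totalVisits.aemeasurable).2
      (integrable_comp_totalVisits ν hγ hg)
  have hs : Summable fun j : ℕ =>
      g (j + 1) * (1 - escapeProb (coord d) (Measure.infinitePi fun _ : ℕ => ν)) ^ j := by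
    refine (hg.congr fun j => ?_).of_abs
    have : (0 : ℝ) ≤ 1 - escapeProb (coord d) (Measure.infinitePi fun _ : ℕ => ν) :=
      sub_nonneg.2 measureReal_le_one
    rw [abs_mul, abs_of_nonneg (pow_nonneg this j)]
  have hterm : ∀ j, ((Measure.infinitePi fun _ : ℕ => ν).map (totalVisits d)).real {j + 1} •
      g (j + 1) = escapeProb (coord d) (Measure.infinitePi fun _ : ℕ => ν) * (g (j + 1) *
        (1 - escapeProb (coord d) (Measure.infinitePi fun _ : ℕ => ν)) ^ j) := by
    intro j
    rw [map_measureReal_apply measurable_totalVisits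
      (measurableSet_singleton _), measureReal_totalVisits_eq ν hγ, smul_eq_mul]
    ring
  rw [← integral_map measurable_totalVisits.aemeasurable hgm, integral_countable h,
    Summable.tsum_eq_zero_add, hg0, smul_zero, zero_add, tsum_congr hterm, tsum_mul_left]
  exact (summable_nat_add_iff 1).1 ((hs.mul_left _).congr fun j => (hterm j).symm)

/-- The law of large numbers for the local time sums of the canonical walk. -/
theorem ae_tendsto_localTimeSum_coord
    (hγ : 0 < escapeProb (coord d) (Measure.infinitePi fun _ : ℕ => ν)) {α : ℝ} (hα : 0 ≤ α) :
    ∀ᵐ y ∂(Measure.infinitePi fun _ : ℕ => ν),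
      Tendsto (fun n : ℕ => localTimeSum (coord d) α n y / (n : ℝ)) atTop
        (𝓝 (∑' j : ℕ, ((j + 1 : ℕ) : ℝ) ^ α *
          escapeProb (coord d) (Measure.infinitePi fun _ : ℕ => ν) ^ 2 *
          (1 - escapeProb (coord d) (Measure.infinitePi fun _ : ℕ => ν)) ^ j)) := by
  set γ := escapeProb (coord d) (Measure.infinitePi fun _ : ℕ => ν) with hγdef
  have hγ1 : γ ≤ 1 := measureReal_le_one
  have hr0 : 0 ≤ 1 - γ := sub_nonneg.2 hγ1
  have hr1 : 1 - γ < 1 := sub_lt_self 1 hγ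
  have hsum := summable_powZero_mul_geometric α hr0 hr1
  have hG : Summable fun j : ℕ => |powZero α (j + 1)| * (1 - γ) ^ j :=
    hsum.congr fun j => by rw [abs_of_nonneg (powZero_nonneg _ _)]
  have hF : Summable fun j : ℕ => |powIncr α (j + 1)| * (1 - γ) ^ j :=
    hsum.of_nonneg_of_le (fun j => mul_nonneg (abs_nonneg _) (pow_nonneg hr0 j)) fun j =>
      mul_le_mul_of_nonneg_right
        ((abs_of_nonneg (powIncr_nonneg hα _)).trans_le (powIncr_le α _)) (pow_nonneg hr0 j)
  -- One factor `γ` comes from the geometric law, the other from summation by parts, where `1 - r =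
  -- γ`.
  have hint : ∫ y, powIncr α (totalVisits d y) ∂(Measure.infinitePi fun _ : ℕ => ν) =
      ∑' j : ℕ, ((j + 1 : ℕ) : ℝ) ^ α * γ ^ 2 * (1 - γ) ^ j := by
    rw [integral_comp_totalVisits ν (g := powIncr α) (by simp [powIncr]) hγ hF, ← hγdef,
      tsum_powIncr_mul_geometric α hr0 hr1, ← tsum_mul_left]
    refine tsum_congr fun j => ?_
    rw [powZero, if_neg j.succ_ne_zero]
    ring
  have hmaker := ae_tendsto_sum_comp_iterate_div (ergodic_shift ν)
    (F := fun m y => powIncr α (localTime (coord d) m 0 y))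
    (f := fun y => powIncr α (totalVisits d y)) (G := fun y => powZero α (totalVisits d y))
    (fun m => (measurable_of_countable (powIncr α)).comp (measurable_localTime m 0))
    ((measurable_of_countable (powIncr α)).comp measurable_totalVisits)
    (integrable_comp_totalVisits ν hγ hF)
    ((measurable_of_countable (powZero α)).comp measurable_totalVisits)
    (integrable_comp_totalVisits ν hγ hG)
    (by
      filter_upwards [ae_bddAbove_localTime ν hγ] with y hy m
      -- Both increments lie between 0 and `powZero α (totalVisits d y)`.
      exact abs_sub_le_of_nonneg_of_le (powIncr_nonneg hα _)
        ((powIncr_le α _).trans (powZero_mono hα (le_ciSup hy m)))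
        (powIncr_nonneg hα _) (powIncr_le α _))
    (by
      filter_upwards [ae_bddAbove_localTime ν hγ] with y hy
      refine tendsto_const_nhds.congr' ?_
      filter_upwards [eventually_localTime_eq hy] with n hn
      rw [hn])
  rw [hint] at hmaker
  filter_upwards [hmaker] with y hy
  exact hy.congr fun n => by rw [localTimeSum_eq_sum]

end RandomWalk

/-! ### Transfer from the canonical walk -/

theorem theorem1 {Ω : Type*} [MeasurableSpace Ω] (P : Measure Ω) [IsProbabilityMeasure P]
    (d : ℕ) (X : ℕ → Ω → (Fin d → ℤ))
    (hmeas : ∀ i, Measurable (X i))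
    (hindep : iIndepFun X P)
    (hident : ∀ i, IdentDistrib (X i) (X 0) P P)
    (hdim : RandomWalk.GenuinelyDDimensional X P)
    (hγ_pos : 0 < RandomWalk.escapeProb X P)
    (hγ_lt : RandomWalk.escapeProb X P < 1)
    (hlow : d = 1 ∨ d = 2 →
      RandomWalk.FiniteSecondMoment X P ∨ RandomWalk.PolynomialReturnTail X P)
    (α : ℝ) (hα : 0 ≤ α) :
    Summable (fun j : ℕ => ((j + 1 : ℕ) : ℝ) ^ α *
      RandomWalk.escapeProb X P ^ 2 * (1 - RandomWalk.escapeProb X P) ^ j) ∧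
    ∀ᵐ ω ∂P, Tendsto (fun n : ℕ => RandomWalk.localTimeSum X α n ω / (n : ℝ)) atTop
      (𝓝 (∑' j : ℕ, ((j + 1 : ℕ) : ℝ) ^ α *
        RandomWalk.escapeProb X P ^ 2 * (1 - RandomWalk.escapeProb X P) ^ j)) := by
  constructor
  · refine ((RandomWalk.summable_powZero_mul_geometric α (sub_nonneg.2 hγ_lt.le)
      (sub_lt_self 1 hγ_pos)).mul_left (RandomWalk.escapeProb X P ^ 2)).congr fun j => ?_
    rw [RandomWalk.powZero, if_neg j.succ_ne_zero]
    ring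
  · have := Measure.isProbabilityMeasure_map (μ := P) (hmeas 0).aemeasurable
    have hXm : Measurable fun ω i => X i ω := measurable_pi_lambda _ hmeas
    -- Escape and local times are functions of the step sequence alone, whose law is the product
    -- measure of the canonical walk.
    have hlaw : P.map (fun ω i => X i ω) = Measure.infinitePi fun _ : ℕ => P.map (X 0) := by
      rw [hindep.map_fun_eq_infinitePi_map hmeas]
      congr 1
      exact funext fun i => (hident i).map_eq
    have hγ : RandomWalk.escapeProb (RandomWalk.coord d)
        (Measure.infinitePi fun _ : ℕ => P.map (X 0)) = RandomWalk.escapeProb X P := by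
      rw [RandomWalk.escapeProb, ← hlaw,
        map_measureReal_apply hXm RandomWalk.measurableSet_escape]
      rfl
    have h := RandomWalk.ae_tendsto_localTimeSum_coord (P.map (X 0)) (hγ ▸ hγ_pos) hα
    rw [hγ, ← hlaw] at h
    exact ae_of_ae_map hXm.aemeasurable h
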